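/- Let $X$ be a vector space over $\mathbb K\in\{\mathbb R,\mathbb C\}$. A fundamental extended locally convex space is such a space with a group topology $\sigma$ for which there are linear subspaces $M,N$ with $X=M\oplus N$ algebraically and topologically, $(M,\sigma|_M)$ a locally convex space and $(N,\sigma|_N)$ discrete. An extended locally convex space (elcs) $(X,\tau)$ is a vector space with a group topology $\tau$ that is the join (coarsest common refinement) of a family of topologies on $X$, each making $X$ a fundamental extended locally convex space; it is called countable if $0$ has a countable neighborhood base. Let $\tau_F$ denote the finest locally convex topology on $X$ that is coarser than $\tau$. Theorem. Let $(X,\tau)$ be a countable Hausdorff elcs, and let $\|\cdot\|$ be a (finite-valued) norm on $X$ such that a linear functional $f:X\to\mathbb K$ is continuous for $\|\cdot\|$ if and only if it is continuous for $\tau$, that is, $(X,\|\cdot\|)^*=(X,\tau)^*$. Then $\tau_F$ is exactly the topology induced by $\|\cdot\|$. -/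

import Mathlib

namespace ELCS

section

variable (𝕜 : Type*) [RCLike 𝕜] {X : Type*} [AddCommGroup X] [Module 𝕜 X] [Module ℝ X]

/-- `σ` is a locally convex topology on the `𝕜`-vector space `X`: it makes `X` a topological vector
space over `𝕜` having a base of convex neighbourhoods (no separation axiom is included).  The real
scalar action is always the restriction of the `𝕜`-action (`IsScalarTower ℝ 𝕜 X`). -/
structure IsLocallyConvexTopology (σ : TopologicalSpace X) : Prop where
  isTopologicalAddGroup : @IsTopologicalAddGroup X σ _
  continuousSMul : @ContinuousSMul 𝕜 X _ _ σ
  locallyConvexSpace : @LocallyConvexSpace ℝ X _ _ _ _ σ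

/-- `(X, τ)` is a fundamental extended locally convex space: `τ` is a group topology and
`X = M ⊕ N` algebraically and topologically (`M × N → X`, `(m, n) ↦ m + n`, is a homeomorphism),
where `M` is a locally convex space and `N` is discrete in the subspace topologies. -/
def IsFundamentalElcs [IsScalarTower ℝ 𝕜 X] (τ : TopologicalSpace X) : Prop :=
  @IsTopologicalAddGroup X τ _ ∧
    ∃ (M N : Submodule 𝕜 X) (h : IsCompl M N),
      IsHomeomorph (Submodule.prodEquivOfIsCompl M N h) ∧
      IsLocallyConvexTopology 𝕜 (inferInstance : TopologicalSpace M) ∧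
      DiscreteTopology N

/-- `(X, τ)` is an extended locally convex space: `τ` is a group topology which is the join (the
coarsest common refinement; in Mathlib's order on topologies this is `sInf`) of a collection of
topologies making `X` a fundamental extended locally convex space. -/
def IsElcs [IsScalarTower ℝ 𝕜 X] (τ : TopologicalSpace X) : Prop :=
  @IsTopologicalAddGroup X τ _ ∧
    ∃ S : Set (TopologicalSpace X), (∀ σ ∈ S, IsFundamentalElcs 𝕜 σ) ∧ τ = sInf S

/-- A countable extended locally convex space: `0` has a countable neighbourhood base. -/
def IsCountableElcs [IsScalarTower ℝ 𝕜 X] (τ : TopologicalSpace X) : Prop :=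
  IsElcs 𝕜 τ ∧ (@nhds X τ 0).IsCountablyGenerated

/-- The finest locally convex topology coarser than `τ`: the join of all locally convex topologies
coarser than `τ`. In Mathlib's order `τ ≤ σ` means that `σ` is coarser than `τ`. -/
@[reducible] def flcTopology (τ : TopologicalSpace X) : TopologicalSpace X :=
  sInf {σ | IsLocallyConvexTopology 𝕜 σ ∧ τ ≤ σ}

/-- The dual of `(X, τ)`: the set of all `τ`-continuous linear functionals on `X`. -/
def dual {X : Type*} [AddCommGroup X] [Module 𝕜 X] (τ : TopologicalSpace X) :
    Set (X →ₗ[𝕜] 𝕜) :=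
  {f | @Continuous X 𝕜 τ _ f}

theorem isLocallyConvexTopology_flcTopology (τ : TopologicalSpace X) :
    IsLocallyConvexTopology 𝕜 (flcTopology 𝕜 τ) where
  isTopologicalAddGroup := topologicalAddGroup_sInf fun _ h => h.1.isTopologicalAddGroup
  continuousSMul := continuousSMul_sInf fun _ h => h.1.continuousSMul
  locallyConvexSpace := LocallyConvexSpace.sInf fun _ h => h.1.locallyConvexSpace

theorem le_flcTopology (τ : TopologicalSpace X) : τ ≤ flcTopology 𝕜 τ :=
  le_sInf fun _ h => h.2

theorem flcTopology_le {τ σ : TopologicalSpace X} (hσ : IsLocallyConvexTopology 𝕜 σ)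
    (h : τ ≤ σ) : flcTopology 𝕜 τ ≤ σ :=
  sInf_le ⟨hσ, h⟩

end

end ELCS

namespace ELCS

open Filter Topology
open scoped NNReal

section

variable {𝕜 : Type*} [RCLike 𝕜] {X : Type*} [AddCommGroup X] [Module 𝕜 X]

/-! Both inclusions rest on uniform boundedness. If a locally convex topology has all its continuous
functionals norm-continuous, each of its continuous seminorms is bounded on the unit ball, so it is
coarser than the norm; this covers `flcTopology`, being coarser than `τ`. Conversely, if no
`τ`-neighbourhood of `0` were norm-bounded, a countable base would give a `τ`-null sequence that is
unbounded but weakly bounded. A bounded neighbourhood and homotheties make the norm coarser than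
`τ`. -/

/-- Uniform boundedness principle for a seminorm: a set on which every `p`-bounded linear
functional is bounded is itself `p`-bounded. -/
theorem exists_seminorm_le_of_forall_functional_bounded (p : Seminorm 𝕜 X) (s : Set X)
    (hs : ∀ f : X →ₗ[𝕜] 𝕜, (∃ C : ℝ, ∀ x, ‖f x‖ ≤ C * p x) → ∃ K : ℝ, ∀ x ∈ s, ‖f x‖ ≤ K) :
    ∃ C : ℝ, ∀ x ∈ s, p x ≤ C := by
  let _ : SeminormedAddCommGroup X := p.toAddGroupSeminorm.toSeminormedAddCommGroup
  let _ : NormedSpace 𝕜 X := ⟨fun a x => (map_smul_eq_mul p a x).le⟩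
  -- Evaluations are operators on the dual, which is complete whether or not `X` is.
  obtain ⟨C, hC⟩ := banach_steinhaus
    (g := fun x : s => NormedSpace.inclusionInDoubleDual 𝕜 X (x : X)) fun f => by
      obtain ⟨K, hK⟩ := hs f.toLinearMap ⟨‖f‖, fun x => f.le_opNorm x⟩
      exact ⟨K, fun x => hK x x.2⟩
  refine ⟨C, fun x hx => ?_⟩
  rw [← show ‖NormedSpace.inclusionInDoubleDual 𝕜 X x‖ = p x from
    (NormedSpace.inclusionInDoubleDualLi (E := X) 𝕜).norm_map x]
  exact hC ⟨x, hx⟩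

section

variable [Module ℝ X] [IsScalarTower ℝ 𝕜 X]

/-- The scalar must be fixed: on the discrete summand `c ↦ c • n` is discontinuous for `n ≠ 0`. -/
theorem IsFundamentalElcs.continuous_const_smul {σ : TopologicalSpace X}
    (hσ : IsFundamentalElcs 𝕜 σ) (c : 𝕜) : Continuous (fun x : X => c • x) := by
  obtain ⟨-, M, N, h, he, hM, hN⟩ := hσ
  have := hM.continuousSMul
  let e := he.homeomorph
  have hc : Continuous fun y : M × N => c • y :=
    (continuous_fst.const_smul c).prodMk (continuous_of_discreteTopology.comp continuous_snd)
  convert e.continuous.comp (hc.comp e.symm.continuous) using 1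
  ext x
  obtain ⟨y, rfl⟩ := e.surjective x
  simp only [Function.comp_apply, e.symm_apply_apply]
  exact (map_smul (Submodule.prodEquivOfIsCompl M N h) c y).symm

theorem IsElcs.continuous_const_smul {τ : TopologicalSpace X} (hτ : IsElcs 𝕜 τ) (c : 𝕜) :
    Continuous (fun x : X => c • x) := by
  obtain ⟨-, S, hS, rfl⟩ := hτ
  exact continuous_sInf_rng.2 fun σ hσ =>
    continuous_sInf_dom hσ ((hS σ hσ).continuous_const_smul c)

theorem IsLocallyConvexTopology.polynormableSpace {σ : TopologicalSpace X}
    (hσ : IsLocallyConvexTopology 𝕜 σ) : PolynormableSpace 𝕜 X := by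
  open scoped ComplexOrder in
  have := hσ.isTopologicalAddGroup
  have := hσ.continuousSMul
  have : ContinuousSMul ℝ X := IsScalarTower.continuousSMul 𝕜
  have : LocallyConvexSpace 𝕜 X := by
    rw [locallyConvexSpace_iff_exists_convex_subset]
    intro x U hU
    obtain ⟨S, hS, hconv, hSU⟩ :=
      (locallyConvexSpace_iff_exists_convex_subset ℝ X).1 hσ.locallyConvexSpace x U hU
    -- Nonnegative elements of `𝕜` are real, so real convexity suffices.
    exact ⟨S, hS, convex_of_nonneg_surjective_algebraMap _
      (fun _ => RCLike.nonneg_iff_exists_ofReal.mp) hconv, hSU⟩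
  infer_instance

end

end

section

variable {𝕜 : Type*} [RCLike 𝕜] {X : Type*} [NormedAddCommGroup X] [NormedSpace 𝕜 X]

theorem _root_.LinearMap.mem_dual_norm (f : X →ₗ[𝕜] 𝕜) (hf : ∃ C : ℝ, ∀ x, ‖f x‖ ≤ C * ‖x‖) :
    f ∈ dual 𝕜 (UniformSpace.toTopologicalSpace : TopologicalSpace X) :=
  let ⟨C, hC⟩ := hf
  (f.mkContinuous C hC).continuous

theorem exists_le_smul_normSeminorm (p : Seminorm 𝕜 X)
    (hp : ∀ f : X →ₗ[𝕜] 𝕜, (∃ C : ℝ, ∀ x, ‖f x‖ ≤ C * p x) →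
      f ∈ dual 𝕜 (UniformSpace.toTopologicalSpace : TopologicalSpace X)) :
    ∃ C : ℝ≥0, p ≤ C • normSeminorm 𝕜 X := by
  obtain ⟨C, hC⟩ := exists_seminorm_le_of_forall_functional_bounded p (Metric.closedBall 0 1)
    fun f hf => by
      let g : StrongDual 𝕜 X := ⟨f, hp f hf⟩
      exact ⟨‖g‖, fun x hx => g.unit_le_opNorm x (mem_closedBall_zero_iff.1 hx)⟩
  refine ⟨C.toNNReal, fun x => ?_⟩
  have hbound : p x ≤ C * ‖x‖ := by
    rcases eq_or_ne x 0 with rfl | hx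
    · simp
    · have hx' : 0 < ‖x‖ := norm_pos_iff.2 hx
      have := hC (((‖x‖⁻¹ : ℝ) : 𝕜) • x) (mem_closedBall_zero_iff.2 (by
        rw [norm_smul, RCLike.norm_ofReal, abs_of_pos (inv_pos.2 hx'), inv_mul_cancel₀ hx'.ne']))
      rw [map_smul_eq_mul, RCLike.norm_ofReal, abs_of_pos (inv_pos.2 hx')] at this
      rwa [inv_mul_le_iff₀ hx', mul_comm] at this
  exact hbound.trans (mul_le_mul_of_nonneg_right (Real.le_coe_toNNReal C) (norm_nonneg x))

variable (𝕜) in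
/-- A countably generated filter along which every bounded functional tends to zero contains a
bounded set. -/
theorem exists_mem_norm_le_of_tendsto_functional (l : Filter X) [l.IsCountablyGenerated]
    (hl : ∀ f ∈ dual 𝕜 (UniformSpace.toTopologicalSpace : TopologicalSpace X),
      Tendsto f l (𝓝 0)) : ∃ V ∈ l, ∃ R : ℝ, ∀ x ∈ V, ‖x‖ ≤ R := by
  obtain ⟨V, hV⟩ := l.exists_antitone_basis
  by_contra! h
  choose x hxV hx using fun n : ℕ => h (V n) (hV.mem n) n
  obtain ⟨C, hC⟩ := exists_seminorm_le_of_forall_functional_bounded (normSeminorm 𝕜 X)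
    (Set.range x) fun f hf => by
      obtain ⟨K, hK⟩ := ((hl f (f.mem_dual_norm hf)).comp (hV.tendsto hxV)).norm.bddAbove_range
      exact ⟨K, by rintro _ ⟨n, rfl⟩; exact hK ⟨n, rfl⟩⟩
  obtain ⟨n, hn⟩ := exists_nat_gt C
  exact absurd (hC (x n) ⟨n, rfl⟩) (not_le.2 (hn.trans (hx n)))

variable [Module ℝ X] [IsScalarTower ℝ 𝕜 X]

variable (𝕜 X) in
theorem isLocallyConvexTopology_norm :
    IsLocallyConvexTopology 𝕜 (UniformSpace.toTopologicalSpace : TopologicalSpace X) where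
  isTopologicalAddGroup := inferInstance
  continuousSMul := inferInstance
  locallyConvexSpace := by
    let _ : NormedSpace ℝ X := ⟨fun r x => by
      rw [← algebraMap_smul 𝕜 r x, norm_smul, norm_algebraMap']⟩
    infer_instance

/-- A normed space carries the finest locally convex topology with its dual. -/
theorem norm_le_of_dual_subset {σ : TopologicalSpace X} (hσ : IsLocallyConvexTopology 𝕜 σ)
    (hdual : dual 𝕜 σ ⊆ dual 𝕜 (UniformSpace.toTopologicalSpace : TopologicalSpace X)) :
    (UniformSpace.toTopologicalSpace : TopologicalSpace X) ≤ σ := by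
  have hw := @PolynormableSpace.withSeminorms 𝕜 X _ _ _ σ hσ.polynormableSpace
  rw [← continuous_id_iff_le]
  refine WithSeminorms.continuous_normedSpace_dom X hw LinearMap.id fun p =>
    exists_le_smul_normSeminorm p.1 fun f ⟨C, hC⟩ => hdual ?_
  refine WithSeminorms.continuous_normedSpace_rng 𝕜 hw f ⟨{p}, C.toNNReal, fun x => ?_⟩
  rw [Finset.sup_singleton]
  exact (hC x).trans (mul_le_mul_of_nonneg_right (Real.le_coe_toNNReal C) (apply_nonneg p.1 x))

/-- A countable elcs topology whose dual contains that of a norm is finer than the norm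
topology. -/
theorem IsCountableElcs.le_norm_of_dual_subset {τ : TopologicalSpace X}
    (hτ : IsCountableElcs 𝕜 τ)
    (hdual : dual 𝕜 (UniformSpace.toTopologicalSpace : TopologicalSpace X) ⊆ dual 𝕜 τ) :
    τ ≤ (UniformSpace.toTopologicalSpace : TopologicalSpace X) := by
  have hcount := hτ.2
  obtain ⟨V, hV, R, hR⟩ := exists_mem_norm_le_of_tendsto_functional 𝕜 (@nhds X τ 0)
    fun f hf => by
      simpa only [map_zero] using @Continuous.tendsto X 𝕜 τ _ f (hdual hf) 0
  have hgroup := hτ.1.1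
  rw [← continuous_id_iff_le]
  refine @continuous_of_continuousAt_zero X τ _ hgroup X (X →+ X) _
    UniformSpace.toTopologicalSpace _ _ _ (AddMonoidHom.id X) ?_
  refine Metric.tendsto_nhds.2 fun ε hε => ?_
  -- Strictly above `R`, so dilating by `(|R| + 1) / ε` into `V` forces `‖x‖ < ε`.
  have hR' : 0 < |R| + 1 := by positivity
  have hc := @Continuous.tendsto X X τ τ _
    (hτ.1.continuous_const_smul (((|R| + 1) / ε : ℝ) : 𝕜)) 0
  rw [smul_zero] at hc
  filter_upwards [hc hV] with x hx
  have hle := hR _ hx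
  rw [norm_smul, RCLike.norm_ofReal, abs_of_pos (div_pos hR' hε)] at hle
  have hlt : (|R| + 1) / ε * ‖x‖ < |R| + 1 := by linarith [le_abs_self R]
  rw [div_mul_eq_mul_div, div_lt_iff₀ hε] at hlt
  simpa using lt_of_mul_lt_mul_left hlt hR'.le

end

end ELCS

theorem mainTheorem10 {𝕜 : Type*} [RCLike 𝕜] {X : Type*} [NormedAddCommGroup X]
    [NormedSpace 𝕜 X] [Module ℝ X] [IsScalarTower ℝ 𝕜 X]
    (τ : TopologicalSpace X)
    (hτ : ELCS.IsCountableElcs 𝕜 τ)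
    (hT2 : @T2Space X τ)
    (hdual : ELCS.dual 𝕜 (UniformSpace.toTopologicalSpace : TopologicalSpace X) =
      ELCS.dual 𝕜 τ) :
    ELCS.flcTopology 𝕜 τ = (UniformSpace.toTopologicalSpace : TopologicalSpace X) := by
  refine le_antisymm (ELCS.flcTopology_le 𝕜 (ELCS.isLocallyConvexTopology_norm 𝕜 X)
    (hτ.le_norm_of_dual_subset hdual.le)) ?_
  refine ELCS.norm_le_of_dual_subset (ELCS.isLocallyConvexTopology_flcTopology 𝕜 τ) ?_
  exact fun f hf => hdual.ge (continuous_le_dom (ELCS.le_flcTopology 𝕜 τ) hf)
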